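/- For $n\ge 3$ let $W_{n+1}$ be the wheel graph with a central vertex $v_c$ joined to every vertex of a rim cycle $v_1v_2\cdots v_nv_1$. For distinct vertices $u,v$ of $W_{n+1}$ let $F_{W_{n+1}}(u\mid v)$ be the number of spanning forests of $W_{n+1}$ (acyclic subgraphs containing all vertices) that have exactly two connected components and in which $u$ and $v$ lie in different components. Let $\mathscr T(W_m)$ denote the number of spanning trees of $W_m$, let $f_i$ be the Fibonacci numbers ($f_0=0$, $f_1=1$, $f_{i+2}=f_{i+1}+f_i$), and let $\ell_j$ be the Lucas numbers ($\ell_0=2$, $\ell_1=1$, $\ell_{j+2}=\ell_{j+1}+\ell_j$). The distance of $v_i$ and $v_j$ along the rim is $\min(|i-j|,\,n-|i-j|)$. Then for every $n\ge 3$: 1. for any two adjacent rim vertices $v_i,v_j$ (such as $v_1,v_2$), $$F_{W_{n+1}}(v_i\mid v_j)=2(f_{2n-1}-1);$$ 2. for any two rim vertices $v_i,v_j$ at distance $2$ along the rim (such as $v_1,v_3$; such pairs exist exactly when $n\ge 4$), $$F_{W_{n+1}}(v_i\mid v_j)=2(\ell_{2n-2}-3)=2(\mathscr T(W_n)-1);$$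 3. for every rim vertex $v_i$ (such as $v_1$), $$F_{W_{n+1}}(v_i\mid v_c)=f_{2n}.$$ -/

import Mathlib

/-- The wheel with `n` rim vertices (hence `n + 1` vertices), for `n ≥ 3`: the vertex `none` is the
center, joined by a spoke to every rim vertex `some i`, and the rim vertices form the `n`-cycle. -/
def wheelGraph (n : ℕ) : SimpleGraph (Option (Fin n)) where
  Adj
    | none, none => False
    | none, some _ => True
    | some _, none => True
    | some i, some j => (SimpleGraph.cycleGraph n).Adj i j
  symm := ⟨by
    rintro (_ | i) (_ | j) h
    · exact h
    · trivial
    · trivial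
    · exact SimpleGraph.Adj.symm h⟩
  loopless := ⟨by
    rintro (_ | i) h
    · exact h
    · exact SimpleGraph.irrefl _ h⟩

/-- The distance between two rim vertices along the rim cycle of length `n`. -/
def rimDist {n : ℕ} (i j : Fin n) : ℕ :=
  min ((i : ℤ) - (j : ℤ)).natAbs (n - ((i : ℤ) - (j : ℤ)).natAbs)

/-- The number of spanning trees of `G`. A spanning subgraph of `G` is a graph `T ≤ G` on the same
vertex set. -/
noncomputable def numSpanningTrees {V : Type*} (G : SimpleGraph V) : ℕ :=
  {T : SimpleGraph V | T ≤ G ∧ T.IsTree}.ncard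

/-- The number of spanning forests of `G` with exactly two components in which `u` and `v` lie in
different components. -/
noncomputable def numTwoForests {V : Type*} (G : SimpleGraph V) (u v : V) : ℕ :=
  {H : SimpleGraph V | H ≤ G ∧ H.IsAcyclic ∧ Nat.card H.ConnectedComponent = 2 ∧
    H.connectedComponentMk u ≠ H.connectedComponentMk v}.ncard

/-- The Lucas numbers `2, 1, 3, 4, 7, 11, …`. -/
def lucasNumber : ℕ → ℕ
  | 0 => 2
  | 1 => 1
  | j + 2 => lucasNumber (j + 1) + lucasNumber j

/-! Choose a set `A` of roots, one in each component of a forest, and let every other vertex point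
to the next vertex towards its root. Forests become maps all of whose orbits end in `A`
(`ncard_rootedForests`): `A = {u, v}` for two-component forests separating `u` and `v`, and a
singleton for spanning trees.

In the wheel a non-root rim vertex points left, right or to the centre, so a map is a three-letter
word on each arc between rim roots. A cycle inside an arc can only be a `right` immediately followed
by a `left`; words of length `m` avoiding this number `fib (2m+2)` (`ncard_goodWords`). If the roots
are the centre and one rim vertex, this is the whole condition, on one arc of length `n - 1`.

If both roots lie on the rim, the centre has a parent too. A root as parent imposes nothing more; a
parent inside an arc forces the letters from there to run straight to an end of the arc, since a
spoke would close a cycle through the centre. Summing over that parent (`sum_ncard_runs`) gives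
`ncard_parentMaps_rimRoots` for arbitrary arc lengths, and lengths 0 and 1 of one arc give the first
two claims. For spanning trees the root is the centre and the words are cyclic, the two constant
ones being excluded as well (`ncard_cyclicWords`). -/

/-! ### Rooted forests as parent maps -/

/-- Iterating `p` from `v` eventually hits the set `A`. -/
inductive Reaches {V : Type*} (p : V → V) (A : Set V) : V → Prop
  | root {v : V} (h : v ∈ A) : Reaches p A v
  | step {v : V} (h : Reaches p A (p v)) : Reaches p A v

/-- `p` encodes a spanning forest of `G` in which each component contains exactly one root `a ∈ A`:
it fixes the roots and sends every other vertex to the next vertex towards its root. -/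
structure IsParentMap {V : Type*} (G : SimpleGraph V) (A : Set V) (p : V → V) : Prop where
  fixed : ∀ a ∈ A, p a = a
  adj : ∀ v ∉ A, G.Adj v (p v)
  reaches : ∀ v, Reaches p A v

/-- The graph whose edges join every vertex to its parent. -/
def parentGraph {V : Type*} (p : V → V) : SimpleGraph V :=
  SimpleGraph.fromRel fun x y => p x = y

section ParentMap

variable {V : Type*} {p : V → V} {A : Set V} {G : SimpleGraph V}

/-- An orbit trapped in an invariant set off `A` never arrives; every cycle below is excluded by
exhibiting such a set. -/
theorem Reaches.not_of_invariant {S : Set V} (hS : ∀ x ∈ S, x ∉ A ∧ p x ∈ S) {x : V}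
    (hx : x ∈ S) : ¬ Reaches p A x := by
  intro h
  induction h with
  | root h => exact (hS _ hx).1 h
  | step _ ih => exact ih (hS _ hx).2

theorem Reaches.eq_of_fixed {a b : V} (hb : p b = b) (h : Reaches p {a} b) : b = a := by
  by_contra hne
  refine Reaches.not_of_invariant (S := {b}) ?_ rfl h
  rintro x rfl
  exact ⟨hne, hb⟩

theorem Reaches.next {v : V} (hf : ∀ a ∈ A, p a = a) (h : Reaches p A v) : Reaches p A (p v) := by
  cases h with
  | root h => rw [hf _ h]; exact .root h
  | step h => exact h

theorem parentGraph_adj {x y : V} : (parentGraph p).Adj x y ↔ x ≠ y ∧ (p x = y ∨ p y = x) :=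
  SimpleGraph.fromRel_adj _ _ _

theorem parentGraph_reachable (v : V) : (parentGraph p).Reachable v (p v) := by
  by_cases h : v = p v
  · rw [← h]
  · exact (parentGraph_adj.2 ⟨h, .inl rfl⟩).reachable

theorem SimpleGraph.Reachable.mem_of_closed {H : SimpleGraph V} {S : Set V}
    (hS : ∀ x y, H.Adj x y → x ∈ S → y ∈ S) {x y : V} (h : H.Reachable x y) (hx : x ∈ S) :
    y ∈ S := by
  obtain ⟨w⟩ := h
  induction w with
  | nil => exact hx
  | cons hadj _ ih => exact ih (hS _ _ hadj hx)

theorem Reaches.exists_root {v : V} (h : Reaches p A v) :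
    ∃ a ∈ A, (parentGraph p).Reachable v a := by
  induction h with
  | root h => exact ⟨_, h, .rfl⟩
  | step _ ih =>
    obtain ⟨a, ha, hr⟩ := ih
    exact ⟨a, ha, (parentGraph_reachable _).trans hr⟩

/-- The points whose orbit hits `a` are closed under adjacency, because `a` is fixed; a fixed point
`b` among them can only be `a`. -/
theorem parentGraph_root_unique (hf : ∀ a ∈ A, p a = a) {a b : V} (ha : a ∈ A) (hb : b ∈ A)
    (h : (parentGraph p).Reachable a b) : a = b := by
  refine (Reaches.eq_of_fixed (p := p) (hf b hb) ?_).symm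
  refine h.mem_of_closed (S := {x | Reaches p {a} x}) ?_ (.root rfl)
  intro x y hxy hx
  obtain ⟨-, rfl | rfl⟩ := parentGraph_adj.1 hxy
  · exact Reaches.next (by rintro _ rfl; exact hf _ ha) hx
  · exact Reaches.step hx

namespace IsParentMap

theorem parentGraph_le (h : IsParentMap G A p) : parentGraph p ≤ G := by
  have key : ∀ x, x ≠ p x → G.Adj x (p x) := fun x hx =>
    h.adj x fun hA => hx (h.fixed x hA).symm
  intro x y hxy
  obtain ⟨hne, rfl | rfl⟩ := parentGraph_adj.1 hxy
  · exact key _ hne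
  · exact (key _ hne.symm).symm

/-- Otherwise `v` lies on a cycle, and the points whose orbit hits `v` form an invariant set off
`A`. -/
theorem not_reaches_parent (h : IsParentMap G A p) {v : V} (hv : v ∉ A) :
    ¬ Reaches p {v} (p v) := by
  intro hr
  refine Reaches.not_of_invariant (p := p) (A := A) (S := {x | Reaches p {v} x}) ?_
    (Reaches.root rfl) (h.reaches v)
  intro x hx
  refine ⟨fun hA => hv ?_, ?_⟩
  · rwa [← Reaches.eq_of_fixed (h.fixed x hA) hx]
  · cases hx with
    | root hx => rw [Set.mem_singleton_iff.1 hx]; exact hr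
    | step hx => exact hx

/-- Every edge joins some `v` to `p v`. Once it is deleted, no edge leaves the set of points whose
orbit hits `v`, and `p v` is outside that set; so every edge is a bridge. -/
theorem isAcyclic (h : IsParentMap G A p) : (parentGraph p).IsAcyclic := by
  have key : ∀ v, v ≠ p v → ¬ ((parentGraph p).deleteEdges {s(v, p v)}).Reachable v (p v) := by
    intro v hv hr
    have hvA : v ∉ A := fun hA => hv (h.fixed v hA).symm
    refine h.not_reaches_parent hvA
      (hr.mem_of_closed (S := {x | Reaches p {v} x}) ?_ (.root rfl))
    intro x y hxy hx
    rw [SimpleGraph.deleteEdges_adj, parentGraph_adj] at hxy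
    obtain ⟨⟨hne, rfl | rfl⟩, hdel⟩ := hxy
    · cases hx with
      | root hx => exact absurd (by rw [Set.mem_singleton_iff.1 hx]; rfl) hdel
      | step hx => exact hx
    · exact Reaches.step hx
  rw [SimpleGraph.isAcyclic_iff_forall_adj_isBridge]
  intro v w hvw
  rw [SimpleGraph.isBridge_iff]
  obtain ⟨hne, rfl | rfl⟩ := parentGraph_adj.1 hvw
  · exact key _ hne
  · intro hr
    rw [Sym2.eq_swap] at hr
    exact key _ hne.symm hr.symm

theorem existsUnique_root (h : IsParentMap G A p) (x : V) :
    ∃! a, a ∈ A ∧ (parentGraph p).Reachable x a := by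
  obtain ⟨a, ha, hr⟩ := (h.reaches x).exists_root
  exact ⟨a, ⟨ha, hr⟩, fun b hb => parentGraph_root_unique h.fixed hb.1 ha (hb.2.symm.trans hr)⟩

/-- Induction towards the root. If the edge from `v` to `p v` is oriented the other way by `q`, the
induction hypothesis gives `p (p v) = v`, a 2-cycle. -/
theorem eq_of_parentGraph_eq {q : V → V} (hp : IsParentMap G A p) (hq : IsParentMap G A q)
    (h : parentGraph p = parentGraph q) : p = q := by
  funext v
  induction hp.reaches v with
  | root hv => rw [hp.fixed _ hv, hq.fixed _ hv]
  | @step v _ ih =>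
    by_cases hv : v ∈ A
    · rw [hp.fixed _ hv, hq.fixed _ hv]
    have hadj : (parentGraph q).Adj v (p v) :=
      h ▸ parentGraph_adj.2 ⟨(hp.adj v hv).ne, .inl rfl⟩
    obtain ⟨-, hvq | hvq⟩ := parentGraph_adj.1 hadj
    · exact hvq.symm
    · rw [hvq] at ih
      refine absurd (Reaches.step ?_) (hp.not_reaches_parent hv)
      rw [ih]
      exact .root rfl

end IsParentMap

theorem SimpleGraph.Reachable.exists_adj_dist_lt {H : SimpleGraph V} {v a : V}
    (h : H.Reachable v a) (hne : v ≠ a) : ∃ w, H.Adj v w ∧ H.dist w a < H.dist v a := by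
  obtain ⟨w, hw⟩ := h.exists_walk_length_eq_dist
  cases w with
  | nil => exact absurd rfl hne
  | @cons _ b _ hadj w =>
    refine ⟨b, hadj, ?_⟩
    rw [← hw, SimpleGraph.Walk.length_cons]
    exact Nat.lt_succ_of_le (SimpleGraph.dist_le w)

/-- The parent is a neighbour closer to the unique root `r v` of the component, so orbits end by
induction on the distance. -/
theorem exists_isParentMap_of_forest {H : SimpleGraph V} (hle : H ≤ G) (hac : H.IsAcyclic)
    (hroot : ∀ x, ∃! a, a ∈ A ∧ H.Reachable x a) :
    ∃ p, IsParentMap G A p ∧ parentGraph p = H := by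
  choose r hr hru using hroot
  have hnext : ∀ v, ∃ w, (v ∈ A → w = v) ∧
      (v ∉ A → H.Adj v w ∧ H.dist w (r v) < H.dist v (r v)) := by
    intro v
    by_cases hv : v ∈ A
    · exact ⟨v, fun _ => rfl, fun h => absurd hv h⟩
    obtain ⟨w, hw⟩ := (hr v).2.exists_adj_dist_lt fun h => hv (h ▸ (hr v).1)
    exact ⟨w, fun h => absurd h hv, fun _ => hw⟩
  choose p hpA hpn using hnext
  have hreach : ∀ v, H.Reachable v (p v) := by
    intro v
    by_cases hv : v ∈ A
    · rw [hpA v hv]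
    · exact (hpn v hv).1.reachable
  have hrp : ∀ v, r (p v) = r v := fun v =>
    ((hru (p v)) (r v) ⟨(hr v).1, (hreach v).symm.trans (hr v).2⟩).symm
  have hreaches : ∀ k v, H.dist v (r v) ≤ k → Reaches p A v := by
    intro k
    induction k with
    | zero =>
      intro v hk
      by_cases hv : v ∈ A
      · exact .root hv
      · exact absurd (hpn v hv).2 (by omega)
    | succ k ih =>
      intro v hk
      by_cases hv : v ∈ A
      · exact .root hv
      · refine .step (ih _ ?_)
        rw [hrp]
        have := (hpn v hv).2
        omega
  have hpm : IsParentMap H A p :=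
    ⟨hpA, fun v hv => (hpn v hv).1, fun v => hreaches _ v le_rfl⟩
  refine ⟨p, ⟨hpA, fun v hv => hle (hpn v hv).1, hpm.reaches⟩, ?_⟩
  refine le_antisymm hpm.parentGraph_le ?_
  intro x y hxy
  by_contra hnot
  have hb := SimpleGraph.isAcyclic_iff_forall_adj_isBridge.1 hac hxy
  rw [SimpleGraph.isBridge_iff] at hb
  refine hb ?_
  -- An edge of `H` missing from the parent graph would not be a bridge: its ends are already joined
  -- there through their common root.
  have hle' : parentGraph p ≤ H.deleteEdges {s(x, y)} := by
    intro a b hab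
    rw [SimpleGraph.deleteEdges_adj]
    refine ⟨hpm.parentGraph_le hab, fun he => ?_⟩
    rcases Sym2.eq_iff.1 (Set.mem_singleton_iff.1 he) with ⟨rfl, rfl⟩ | ⟨rfl, rfl⟩
    · exact hnot hab
    · exact hnot hab.symm
  refine SimpleGraph.Reachable.mono hle' ?_
  obtain ⟨a, ha, hxa⟩ := (hpm.reaches x).exists_root
  obtain ⟨b, hb, hyb⟩ := (hpm.reaches y).exists_root
  have h1 : a = r x := hru x a ⟨ha, hxa.mono hpm.parentGraph_le⟩
  have h2 : b = r x :=
    hru x b ⟨hb, hxy.reachable.trans (hyb.mono hpm.parentGraph_le)⟩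
  rw [h1] at hxa
  rw [h2] at hyb
  exact hxa.trans hyb.symm

/-- Spanning forests with one root of `A` in each component correspond to parent maps. -/
theorem ncard_rootedForests (G : SimpleGraph V) (A : Set V) :
    {H : SimpleGraph V | H ≤ G ∧ H.IsAcyclic ∧ ∀ x, ∃! a, a ∈ A ∧ H.Reachable x a}.ncard =
      {p | IsParentMap G A p}.ncard := by
  symm
  refine Set.ncard_congr (fun p _ => parentGraph p) ?_ ?_ ?_
  · exact fun p hp => ⟨hp.parentGraph_le, hp.isAcyclic, hp.existsUnique_root⟩
  · exact fun p q hp hq h => hp.eq_of_parentGraph_eq hq h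
  · rintro H ⟨hle, hac, hroot⟩
    obtain ⟨p, hp, rfl⟩ := exists_isParentMap_of_forest hle hac hroot
    exact ⟨p, hp, rfl⟩

theorem numSpanningTrees_eq_ncard_parentMaps (G : SimpleGraph V) (c : V) :
    numSpanningTrees G = {p | IsParentMap G {c} p}.ncard := by
  rw [← ncard_rootedForests, numSpanningTrees]
  congr 1
  ext H
  refine and_congr_right fun _ => ?_
  rw [SimpleGraph.isTree_iff, and_comm]
  refine and_congr_right fun _ => ?_
  constructor
  · intro h x
    exact ⟨c, ⟨rfl, h.preconnected x c⟩, fun _ hb => hb.1⟩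
  · intro h
    have hc : ∀ x, H.Reachable x c := by
      intro x
      obtain ⟨a, ⟨rfl, ha⟩, -⟩ := h x
      exact ha
    have : Nonempty V := ⟨c⟩
    exact ⟨fun x y => (hc x).trans (hc y).symm⟩

theorem numTwoForests_eq_ncard_parentMaps (G : SimpleGraph V) (u v : V) (huv : u ≠ v) :
    numTwoForests G u v = {p | IsParentMap G {u, v} p}.ncard := by
  rw [← ncard_rootedForests, numTwoForests]
  congr 1
  ext H
  refine and_congr_right fun _ => and_congr_right fun _ => ?_
  constructor
  · rintro ⟨hcard, hne⟩ x
    have hcov : ∀ c : H.ConnectedComponent,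
        c = H.connectedComponentMk u ∨ c = H.connectedComponentMk v := by
      intro c
      obtain ⟨a, b, hab, huniv⟩ := Nat.card_eq_two_iff.1 hcard
      have h1 : c ∈ ({a, b} : Set _) := huniv ▸ Set.mem_univ _
      have h2 : H.connectedComponentMk u ∈ ({a, b} : Set _) := huniv ▸ Set.mem_univ _
      have h3 : H.connectedComponentMk v ∈ ({a, b} : Set _) := huniv ▸ Set.mem_univ _
      simp only [Set.mem_insert_iff, Set.mem_singleton_iff] at h1 h2 h3
      grind
    simp only [← SimpleGraph.ConnectedComponent.eq]
    rcases hcov (H.connectedComponentMk x) with h | h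
    · refine ⟨u, ⟨by simp, h⟩, ?_⟩
      rintro b ⟨rfl | rfl, hb⟩
      · rfl
      · exact absurd (h.symm.trans hb) hne
    · refine ⟨v, ⟨by simp, h⟩, ?_⟩
      rintro b ⟨rfl | rfl, hb⟩
      · exact absurd (hb.symm.trans h) hne
      · rfl
  · intro h
    have hne : H.connectedComponentMk u ≠ H.connectedComponentMk v := by
      intro he
      rw [SimpleGraph.ConnectedComponent.eq] at he
      exact huv ((h u).unique ⟨by simp, .rfl⟩ ⟨by simp, he⟩)
    refine ⟨Nat.card_eq_two_iff.2 ⟨_, _, hne, ?_⟩, hne⟩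
    refine Set.eq_univ_of_forall fun c => ?_
    induction c using SimpleGraph.ConnectedComponent.ind with
    | h x =>
      obtain ⟨a, ⟨rfl | rfl, ha⟩, -⟩ := h x
      · exact .inl (SimpleGraph.ConnectedComponent.eq.2 ha)
      · exact .inr (SimpleGraph.ConnectedComponent.eq.2 ha)

end ParentMap

/-! ### Counting words of directions -/

/-- A direction in which a rim vertex of the wheel may point. -/
inductive Dir
  | left
  | right
  | spoke
  deriving DecidableEq

namespace Dir

instance : Fintype Dir := ⟨{left, right, spoke}, fun d => by cases d <;> simp⟩

/-- Exchange `left` and `right`. -/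
def flip : Dir → Dir
  | left => right
  | right => left
  | spoke => spoke

@[simp] theorem flip_flip (d : Dir) : d.flip.flip = d := by cases d <;> rfl

theorem flip_eq_right {d : Dir} : d.flip = right ↔ d = left := by cases d <;> simp [flip]

theorem flip_eq_left {d : Dir} : d.flip = left ↔ d = right := by cases d <;> simp [flip]

end Dir

section Words

variable {m : ℕ}

/-- The words in which no `right` is immediately followed by a `left`. -/
def goodWords (m : ℕ) : Set (Fin m → Dir) :=
  {y | ∀ (i : ℕ) (h : i + 1 < m), ¬ (y ⟨i, by omega⟩ = .right ∧ y ⟨i + 1, h⟩ = .left)}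

/-- The mirror image of a word. -/
def mirror (y : Fin m → Dir) : Fin m → Dir := fun i => (y i.rev).flip

theorem mirror_mirror (y : Fin m → Dir) : mirror (mirror y) = y := by
  funext i
  simp [mirror]

theorem mirror_injective : Function.Injective (mirror (m := m)) :=
  Function.LeftInverse.injective mirror_mirror

theorem mirror_mem_goodWords {y : Fin m → Dir} (h : y ∈ goodWords m) :
    mirror y ∈ goodWords m := by
  rintro i hi ⟨h1, h2⟩
  rw [mirror, Dir.flip_eq_right] at h1
  rw [mirror, Dir.flip_eq_left] at h2
  refine h (m - (i + 1 + 1)) (by omega) ⟨?_, ?_⟩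
  · rw [← h2]
    congr 1
  · rw [← h1]
    congr 1
    ext
    simp only [Fin.val_rev]
    omega

theorem snoc_injective (t : Dir) :
    Function.Injective fun y : Fin m → Dir => (Fin.snoc y t : Fin (m + 1) → Dir) :=
  Fin.snoc_left_injective (α := fun _ => Dir) t

theorem snoc_mem_goodWords {y : Fin m → Dir} {t : Dir} :
    (Fin.snoc y t : Fin (m + 1) → Dir) ∈ goodWords (m + 1) ↔
      y ∈ goodWords m ∧ (t = .left → ∀ h : 0 < m, y ⟨m - 1, by omega⟩ ≠ .right) := by
  constructor
  · intro h
    refine ⟨fun i hi hy => h i (by omega) ?_, ?_⟩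
    · simpa [Fin.snoc, hi, show i < m by omega] using hy
    · rintro rfl hm hy
      refine h (m - 1) (by omega) ?_
      simpa [Fin.snoc, hm, show ¬ (m - 1 + 1 < m) by omega] using hy
  · rintro ⟨h1, h2⟩ i hi ⟨ha, hb⟩
    by_cases him : i + 1 < m
    · refine h1 i him ⟨?_, ?_⟩
      · simpa [Fin.snoc, show i < m by omega] using ha
      · simpa [Fin.snoc, him] using hb
    · obtain rfl : m = i + 1 := by omega
      refine h2 ?_ (by omega) ?_
      · simpa [Fin.snoc] using hb
      · simpa [Fin.snoc] using ha

theorem snoc_right_mem_goodWords {y : Fin m → Dir} :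
    (Fin.snoc y .right : Fin (m + 1) → Dir) ∈ goodWords (m + 1) ↔ y ∈ goodWords m := by
  simp [snoc_mem_goodWords]

theorem cons_left_mem_goodWords {y : Fin m → Dir} :
    (Fin.cons .left y : Fin (m + 1) → Dir) ∈ goodWords (m + 1) ↔ y ∈ goodWords m := by
  constructor
  · intro h i hi hy
    exact h (i + 1) (by omega) hy
  · rintro h i hi ⟨ha, hb⟩
    cases i with
    | zero => simp at ha
    | succ i => exact h i (by omega) ⟨ha, hb⟩

theorem goodWords_last_right :
    {y ∈ goodWords (m + 1) | y (Fin.last m) = .right} =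
      (fun y : Fin m → Dir => (Fin.snoc y .right : Fin (m + 1) → Dir)) '' goodWords m := by
  ext y
  constructor
  · rintro ⟨hy, hl⟩
    refine ⟨Fin.init y, ?_, ?_⟩
    · rw [← snoc_right_mem_goodWords, ← hl, Fin.snoc_init_self]
      exact hy
    · simp only [← hl, Fin.snoc_init_self]
  · rintro ⟨y, hy, rfl⟩
    exact ⟨snoc_right_mem_goodWords.2 hy, Fin.snoc_last _ _⟩

theorem ncard_goodWords_last_right :
    {y ∈ goodWords (m + 1) | y (Fin.last m) = .right}.ncard = (goodWords m).ncard := by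
  rw [goodWords_last_right, Set.ncard_image_of_injective _ (snoc_injective _)]

theorem goodWords_last_spoke :
    {y ∈ goodWords (m + 1) | y (Fin.last m) = .spoke} =
      (fun y : Fin m → Dir => (Fin.snoc y .spoke : Fin (m + 1) → Dir)) '' goodWords m := by
  ext y
  constructor
  · rintro ⟨hy, hl⟩
    refine ⟨Fin.init y, ?_, ?_⟩
    · rw [← Fin.snoc_init_self y] at hy
      exact (snoc_mem_goodWords.1 hy).1
    · simp only [← hl, Fin.snoc_init_self]
  · rintro ⟨y, hy, rfl⟩
    exact ⟨snoc_mem_goodWords.2 ⟨hy, by simp⟩, Fin.snoc_last _ _⟩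

theorem goodWords_last_left :
    {y ∈ goodWords (m + 2) | y (Fin.last (m + 1)) = .left} =
      (fun y : Fin (m + 1) → Dir => (Fin.snoc y .left : Fin (m + 2) → Dir)) ''
        (goodWords (m + 1) \ {y ∈ goodWords (m + 1) | y (Fin.last m) = .right}) := by
  ext y
  constructor
  · rintro ⟨hy, hl⟩
    refine ⟨Fin.init y, ?_, ?_⟩
    · rw [← Fin.snoc_init_self y, snoc_mem_goodWords] at hy
      exact ⟨hy.1, fun h => hy.2 hl (by omega) h.2⟩
    · simp only [← hl, Fin.snoc_init_self]
  · rintro ⟨y, hy, rfl⟩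
    exact ⟨snoc_mem_goodWords.2 ⟨hy.1, fun _ _ h => hy.2 ⟨hy.1, h⟩⟩, Fin.snoc_last _ _⟩

theorem ncard_eq_add_last (S : Set (Fin (m + 1) → Dir)) :
    S.ncard = {y ∈ S | y (Fin.last m) = .right}.ncard +
      {y ∈ S | y (Fin.last m) = .spoke}.ncard + {y ∈ S | y (Fin.last m) = .left}.ncard := by
  rw [← Set.ncard_union_eq, ← Set.ncard_union_eq]
  · congr 1
    ext y
    simp only [Set.mem_union, Set.mem_ofPred_eq]
    cases y (Fin.last m) <;> simp
  · rw [Set.disjoint_left]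
    rintro y (⟨-, h1⟩ | ⟨-, h1⟩) ⟨-, h2⟩ <;> simp [h1] at h2
  · rw [Set.disjoint_left]
    rintro y ⟨-, h1⟩ ⟨-, h2⟩
    simp [h1] at h2

theorem ncard_goodWords_zero : (goodWords 0).ncard = 1 := by
  have : goodWords 0 = {Fin.elim0} := by
    ext y
    simp [goodWords, eq_iff_true_of_subsingleton]
  rw [this, Set.ncard_singleton]

theorem ncard_goodWords_one : (goodWords 1).ncard = 3 := by
  have : goodWords 1 = Set.univ := Set.eq_univ_of_forall fun y i hi => absurd hi (by omega)
  rw [this, Set.ncard_univ, Nat.card_eq_fintype_card]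
  rfl

/-- By last letter: `right` and `spoke` extend any good word, `left` only those not ending in
`right`. This is the recursion of the even-indexed Fibonacci numbers. -/
theorem ncard_goodWords_add_two (m : ℕ) :
    (goodWords (m + 2)).ncard + (goodWords m).ncard = 3 * (goodWords (m + 1)).ncard := by
  have hsub : {y ∈ goodWords (m + 1) | y (Fin.last m) = .right} ⊆ goodWords (m + 1) :=
    Set.sep_subset _ _
  have h := Set.ncard_sdiff_add_ncard_of_subset hsub
  rw [ncard_goodWords_last_right] at h
  rw [ncard_eq_add_last (goodWords (m + 2)), ncard_goodWords_last_right, goodWords_last_spoke,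
    goodWords_last_left, Set.ncard_image_of_injective _ (snoc_injective _),
    Set.ncard_image_of_injective _ (snoc_injective _)]
  omega

theorem ncard_goodWords (m : ℕ) : (goodWords m).ncard = Nat.fib (2 * m + 2) := by
  induction m using Nat.twoStepInduction with
  | zero => simp [ncard_goodWords_zero]
  | one => simp [ncard_goodWords_one, Nat.fib_add_two]
  | more m h0 h1 =>
    have h := ncard_goodWords_add_two m
    rw [h0, h1] at h
    have e1 : Nat.fib (2 * (m + 2) + 2) = Nat.fib (2 * m + 4) + Nat.fib (2 * m + 5) :=
      Nat.fib_add_two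
    have e2 : Nat.fib (2 * m + 5) = Nat.fib (2 * m + 3) + Nat.fib (2 * m + 4) := Nat.fib_add_two
    have e3 : Nat.fib (2 * m + 4) = Nat.fib (2 * m + 2) + Nat.fib (2 * m + 3) := Nat.fib_add_two
    have e4 : Nat.fib (2 * (m + 1) + 2) = Nat.fib (2 * m + 4) := rfl
    omega

/-- The good words that are constantly `right` from position `q` on. -/
def rightRuns (q : Fin m) : Set (Fin m → Dir) := {y ∈ goodWords m | ∀ j, q ≤ j → y j = .right}

/-- The good words that are constantly `left` up to position `q`. -/
def leftRuns (q : Fin m) : Set (Fin m → Dir) := {y ∈ goodWords m | ∀ j, j ≤ q → y j = .left}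

theorem ncard_rightRuns_castSucc (q : Fin m) :
    (rightRuns q.castSucc).ncard = (rightRuns q).ncard := by
  have : rightRuns q.castSucc =
      (fun y : Fin m → Dir => (Fin.snoc y .right : Fin (m + 1) → Dir)) '' rightRuns q := by
    ext y
    constructor
    · rintro ⟨hy, hl⟩
      have hlast := hl (Fin.last m) (Fin.le_last _)
      refine ⟨Fin.init y, ⟨?_, fun j hj => hl _ (by simpa using hj)⟩, ?_⟩
      · rw [← snoc_right_mem_goodWords, ← hlast, Fin.snoc_init_self]
        exact hy
      · simp only [← hlast, Fin.snoc_init_self]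
    · rintro ⟨y, hy, rfl⟩
      refine ⟨snoc_right_mem_goodWords.2 hy.1, fun j hj => ?_⟩
      induction j using Fin.lastCases with
      | last => exact Fin.snoc_last _ _
      | cast j =>
        simp only [Fin.snoc_castSucc]
        exact hy.2 j (by simpa using hj)
  rw [this, Set.ncard_image_of_injective _ (snoc_injective _)]

theorem ncard_rightRuns_last : (rightRuns (Fin.last m)).ncard = (goodWords m).ncard := by
  rw [← ncard_goodWords_last_right]
  congr 1
  ext y
  refine and_congr_right fun _ => ⟨fun h => h _ le_rfl, fun h j hj => ?_⟩
  rwa [Fin.last_le_iff.1 hj]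

/-- Stripping the final `right`s shows that `rightRuns q` is as large as `goodWords q`, so the sum
is one of even-indexed Fibonacci numbers. -/
theorem sum_ncard_rightRuns (m : ℕ) :
    ∑ q : Fin m, (rightRuns q).ncard + 1 = Nat.fib (2 * m + 1) := by
  induction m with
  | zero => simp
  | succ m ih =>
    rw [Fin.sum_univ_castSucc]
    simp only [ncard_rightRuns_castSucc, ncard_rightRuns_last, ncard_goodWords]
    have : Nat.fib (2 * (m + 1) + 1) = Nat.fib (2 * m + 1) + Nat.fib (2 * m + 2) :=
      Nat.fib_add_two
    omega

theorem ncard_leftRuns (q : Fin m) : (leftRuns q).ncard = (rightRuns q.rev).ncard := by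
  have : leftRuns q = mirror '' rightRuns q.rev := by
    ext y
    constructor
    · rintro ⟨hy, hl⟩
      refine ⟨mirror y, ⟨mirror_mem_goodWords hy, fun j hj => ?_⟩, mirror_mirror y⟩
      rw [mirror, Dir.flip_eq_right]
      exact hl _ (Fin.rev_le_iff.1 hj)
    · rintro ⟨y, hy, rfl⟩
      refine ⟨mirror_mem_goodWords hy.1, fun j hj => ?_⟩
      rw [mirror, Dir.flip_eq_left]
      exact hy.2 _ (Fin.rev_le_rev.2 hj)
  rw [this, Set.ncard_image_of_injective _ mirror_injective]

theorem sum_ncard_leftRuns (m : ℕ) :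
    ∑ q : Fin m, (leftRuns q).ncard + 1 = Nat.fib (2 * m + 1) := by
  rw [← sum_ncard_rightRuns]
  simp only [ncard_leftRuns]
  rw [← Equiv.sum_comp Fin.revPerm]
  simp

/-- The good words for which following the directions from position `q` leads to an end. -/
def runs (q : Fin m) : Set (Fin m → Dir) := rightRuns q ∪ leftRuns q

theorem sum_ncard_runs (m : ℕ) :
    ∑ q : Fin m, (runs q).ncard + 2 = 2 * Nat.fib (2 * m + 1) := by
  have h : ∀ q : Fin m, (runs q).ncard = (rightRuns q).ncard + (leftRuns q).ncard := by
    intro q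
    refine Set.ncard_union_eq ?_
    rw [Set.disjoint_left]
    rintro y ⟨-, h1⟩ ⟨-, h2⟩
    exact absurd ((h1 q le_rfl).symm.trans (h2 q le_rfl)) (by simp)
  simp only [h, Finset.sum_add_distrib]
  have := sum_ncard_rightRuns m
  have := sum_ncard_leftRuns m
  omega

/-- The good cyclic words that are neither constantly `left` nor constantly `right`. -/
def cyclicWords (m : ℕ) : Set (Fin (m + 2) → Dir) :=
  {y ∈ goodWords (m + 2) | ¬ (y 0 = .left ∧ y (Fin.last _) = .right) ∧
    y ≠ (fun _ => .left) ∧ y ≠ fun _ => .right}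

theorem ncard_cyclicWords (m : ℕ) :
    (cyclicWords m).ncard + Nat.fib (2 * m + 2) + 2 = Nat.fib (2 * m + 6) := by
  -- `B` holds the words whose forbidden pair appears only across the seam. Their middle is an
  -- arbitrary good word, as a leading `left` or a trailing `right` never creates a forbidden pair.
  set B : Set (Fin (m + 2) → Dir) :=
    (fun y : Fin m → Dir =>
      (Fin.cons .left (Fin.snoc y .right : Fin (m + 1) → Dir) : Fin (m + 2) → Dir)) '' goodWords m
    with hB
  set C : Set (Fin (m + 2) → Dir) := {fun _ => .left, fun _ => .right} with hC
  have hBmem : ∀ y, y ∈ B ↔ y ∈ goodWords (m + 2) ∧ y 0 = .left ∧ y (Fin.last _) = .right := by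
    intro y
    constructor
    · rintro ⟨y, hy, rfl⟩
      refine ⟨cons_left_mem_goodWords.2 (snoc_right_mem_goodWords.2 hy), rfl, ?_⟩
      rw [← Fin.succ_last]
      simp
    · rintro ⟨hy, h0, hl⟩
      have e : (Fin.cons .left (Fin.snoc (Fin.init (Fin.tail y)) .right : Fin (m + 1) → Dir) :
          Fin (m + 2) → Dir) = y := by
        have : (Fin.snoc (Fin.init (Fin.tail y)) .right : Fin (m + 1) → Dir) = Fin.tail y := by
          rw [← hl]
          exact Fin.snoc_init_self (Fin.tail y)
        rw [this, ← h0]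
        exact Fin.cons_self_tail y
      refine ⟨Fin.init (Fin.tail y), ?_, e⟩
      rwa [← e, cons_left_mem_goodWords, snoc_right_mem_goodWords] at hy
  have hBcard : B.ncard = Nat.fib (2 * m + 2) := by
    rw [hB, Set.ncard_image_of_injective, ncard_goodWords]
    exact (Fin.cons_right_injective _).comp (snoc_injective _)
  have hCcard : C.ncard = 2 := by
    refine Set.ncard_pair fun h => ?_
    have := congrFun h 0
    simp at this
  have hdisj : Disjoint B C := by
    rw [Set.disjoint_left]
    rintro y hy (rfl | rfl) <;> simp [hBmem] at hy
  have hsub : B ∪ C ⊆ goodWords (m + 2) := by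
    rintro y (hy | rfl | rfl)
    · exact ((hBmem y).1 hy).1
    · rintro i hi ⟨h, -⟩
      simp at h
    · rintro i hi ⟨-, h⟩
      simp at h
  have hcyc : cyclicWords m = goodWords (m + 2) \ (B ∪ C) := by
    ext y
    simp only [cyclicWords, Set.mem_sdiff, Set.mem_union, hBmem, hC, Set.mem_ofPred_eq,
      Set.mem_insert_iff, Set.mem_singleton_iff]
    tauto
  have h := Set.ncard_sdiff_add_ncard_of_subset hsub
  rw [Set.ncard_union_eq hdisj, hBcard, hCcard, ← hcyc, ncard_goodWords] at h
  rw [add_assoc, h]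
  rfl

end Words

/-! ### Maps following a word along a path -/

/-- The vertex in direction `d`, given the left and right neighbours and the centre. -/
def Dir.dest {V : Type*} (d : Dir) (l r c : V) : V :=
  match d with
  | left => l
  | right => r
  | spoke => c

theorem Dir.dest_flip {V : Type*} (d : Dir) (l r c : V) : d.flip.dest l r c = d.dest r l c := by
  cases d <;> rfl

section Path

variable {V : Type*} {p : V → V} {c : V} {m : ℕ} {w : ℕ → V} {y : Fin m → Dir}

/-- `p` acts on the inner vertices `w 1, …, w m` of the path `w 0, …, w (m + 1)` as told by the
word `y`. -/
def FollowsWord (p : V → V) (c : V) (w : ℕ → V) (y : Fin m → Dir) : Prop :=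
  ∀ k : Fin m, p (w (k + 1)) = (y k).dest (w k) (w (k + 2)) c

namespace FollowsWord

theorem mirror (h : FollowsWord p c w y) :
    FollowsWord p c (fun k => w (m + 1 - k)) (mirror y) := by
  intro k
  have hk := h k.rev
  simp only [Fin.val_rev] at hk
  simp only [_root_.mirror, Dir.dest_flip]
  rw [show m + 1 - (k + 1 : ℕ) = m - (k + 1) + 1 by omega, hk]
  congr 2 <;> omega

/-- In a good word the letter after a `right` is `right` or `spoke`, so the orbit moves right until
it meets the centre or the end. -/
theorem of_right (h : FollowsWord p c w y) (hy : y ∈ goodWords m) {S : V → Prop}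
    (hS : ∀ v, S (p v) → S v) (hc : S c) (hend : S (w (m + 1))) (k : Fin m)
    (hk : y k = .right) : S (w (k + 1)) := by
  obtain ⟨j, hj⟩ : ∃ j, m = k + 1 + j := ⟨m - (k + 1), by omega⟩
  induction j generalizing k with
  | zero =>
    refine hS _ ?_
    rw [h k, hk, show (k : ℕ) + 2 = m + 1 by omega]
    exact hend
  | succ j ih =>
    refine hS _ ?_
    rw [h k, hk]
    change S (w (k + 1 + 1))
    have hlt : (k : ℕ) + 1 < m := by omega
    cases hd : y ⟨k + 1, hlt⟩ with
    | left => exact absurd ⟨hk, hd⟩ (hy k hlt)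
    | right => exact ih ⟨k + 1, hlt⟩ hd (by simp only; omega)
    | spoke =>
      refine hS _ ?_
      have := h ⟨k + 1, hlt⟩
      rw [hd] at this
      simp only at this
      rw [this]
      exact hc

/-- Along a good word, a property that pulls back along `p` and holds at both ends of the path and
at the centre holds on the whole path. -/
theorem of_good (h : FollowsWord p c w y) (hy : y ∈ goodWords m) {S : V → Prop}
    (hS : ∀ v, S (p v) → S v) (hc : S c) (h0 : S (w 0)) (hend : S (w (m + 1))) (k : Fin m) :
    S (w (k + 1)) := by
  cases hk : y k with
  | right => exact h.of_right hy hS hc hend k hk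
  | spoke =>
    refine hS _ ?_
    rw [h k, hk]
    exact hc
  | left =>
    have := h.mirror.of_right (mirror_mem_goodWords hy) hS hc (by simpa using h0) k.rev
      (by simp [_root_.mirror, hk, Dir.flip])
    simp only [Fin.val_rev] at this
    rwa [show m + 1 - (m - ((k : ℕ) + 1) + 1) = k + 1 by omega] at this

theorem of_rightRun (h : FollowsWord p c w y) {q : Fin m} (hy : y ∈ rightRuns q) {S : V → Prop}
    (hS : ∀ v, S (p v) → S v) (hend : S (w (m + 1))) : S (w (q + 1)) := by
  obtain ⟨j, hj⟩ : ∃ j, m = q + 1 + j := ⟨m - (q + 1), by omega⟩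
  induction j generalizing q with
  | zero =>
    refine hS _ ?_
    rw [h q, hy.2 q le_rfl, show (q : ℕ) + 2 = m + 1 by omega]
    exact hend
  | succ j ih =>
    refine hS _ ?_
    rw [h q, hy.2 q le_rfl]
    have hlt : (q : ℕ) + 1 < m := by omega
    refine ih (q := ⟨q + 1, hlt⟩) ⟨hy.1, fun i hi => hy.2 i ?_⟩ (by simp only; omega)
    rw [Fin.le_def] at hi ⊢
    simp only at hi
    omega

theorem of_run (h : FollowsWord p c w y) {q : Fin m} (hy : y ∈ runs q) {S : V → Prop}
    (hS : ∀ v, S (p v) → S v) (h0 : S (w 0)) (hend : S (w (m + 1))) : S (w (q + 1)) := by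
  rcases hy with hy | hy
  · exact h.of_rightRun hy hS hend
  · have := h.mirror.of_rightRun (q := q.rev) (S := S)
      ⟨mirror_mem_goodWords hy.1, fun j hj => by
        rw [_root_.mirror, Dir.flip_eq_right]
        exact hy.2 _ (Fin.rev_le_iff.1 hj)⟩ hS (by simpa using h0)
    simp only [Fin.val_rev] at this
    rwa [show m + 1 - (m - ((q : ℕ) + 1) + 1) = q + 1 by omega] at this

/-- A `right` followed by a `left` makes two vertices point at each other. -/
theorem mem_goodWords (h : FollowsWord p c w y) {A : Set V}
    (hA : ∀ k : Fin m, w (k + 1) ∉ A) (hr : ∀ k : Fin m, Reaches p A (w (k + 1))) :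
    y ∈ goodWords m := by
  rintro i hi ⟨h1, h2⟩
  refine Reaches.not_of_invariant (S := {w (i + 1), w (i + 2)}) ?_ (Set.mem_insert _ _)
    (hr ⟨i, by omega⟩)
  have e1 := h ⟨i, by omega⟩
  have e2 := h ⟨i + 1, hi⟩
  rw [h1] at e1
  rw [h2] at e2
  rintro x (rfl | rfl)
  · exact ⟨hA ⟨i, by omega⟩, .inr e1⟩
  · exact ⟨hA ⟨i + 1, hi⟩, .inl e2⟩

/-- When the centre points at position `q`, a spoke later in the run would lead back to the centre,
and a `left` after a `right` is forbidden. -/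
theorem mem_rightRuns (h : FollowsWord p c w y) {A : Set V} (hA : ∀ k : Fin m, w (k + 1) ∉ A)
    (hcA : c ∉ A) (hy : y ∈ goodWords m) {q : Fin m} (hq : p c = w (q + 1))
    (hr : Reaches p A c) (hyq : y q = .right) : y ∈ rightRuns q := by
  -- All letters up to `j` are carried along, since the trapped set in the spoke case is the centre
  -- together with the whole run.
  have key : ∀ j (hj : (q : ℕ) + j < m), ∀ i ≤ j, ∀ hi : (q : ℕ) + i < m,
      y ⟨q + i, hi⟩ = .right := by
    intro j
    induction j with
    | zero =>
      intro _ i hi _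
      obtain rfl : i = 0 := by omega
      exact hyq
    | succ j ih =>
      intro hj i hi hi'
      rcases Nat.lt_or_ge i (j + 1) with hij | hij
      · exact ih (by omega) i (by omega) hi'
      obtain rfl : i = j + 1 := by omega
      have ihj := ih (by omega)
      cases hd : y ⟨q + (j + 1), hi'⟩ with
      | right => rfl
      | left => exact absurd ⟨ihj j le_rfl (by omega), hd⟩ (hy (q + j) hi')
      | spoke =>
        refine absurd hr (Reaches.not_of_invariant
          (S := {x | x = c ∨ ∃ i ≤ j + 1, x = w (q + i + 1)}) ?_ (.inl rfl))
        rintro x (rfl | ⟨i, hi, rfl⟩)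
        · exact ⟨hcA, .inr ⟨0, by omega, hq⟩⟩
        · refine ⟨hA ⟨q + i, by omega⟩, ?_⟩
          have e := h ⟨q + i, by omega⟩
          rcases Nat.lt_or_ge i (j + 1) with hij | hij
          · rw [ihj i (by omega) (by omega)] at e
            exact .inr ⟨i + 1, by omega, e⟩
          · obtain rfl : i = j + 1 := by omega
            rw [hd] at e
            exact .inl e
  refine ⟨hy, fun j hj => ?_⟩
  have hj' : (q : ℕ) ≤ j := hj
  have := key (j - q) (by omega) (j - q) le_rfl (by omega)
  rw [← this]
  congr 1
  ext
  simp only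
  omega

theorem mem_runs (h : FollowsWord p c w y) {A : Set V} (hA : ∀ k : Fin m, w (k + 1) ∉ A)
    (hcA : c ∉ A) (hy : y ∈ goodWords m) {q : Fin m} (hq : p c = w (q + 1))
    (hr : Reaches p A c) : y ∈ runs q := by
  cases hyq : y q with
  | right => exact .inl (h.mem_rightRuns hA hcA hy hq hr hyq)
  | spoke =>
    refine absurd hr (Reaches.not_of_invariant (S := {c, w (q + 1)}) ?_ (Set.mem_insert _ _))
    have e := h q
    rw [hyq] at e
    rintro x (rfl | rfl)
    · exact ⟨hcA, .inr hq⟩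
    · exact ⟨hA q, .inl e⟩
  | left =>
    right
    have := h.mirror.mem_rightRuns (A := A) (q := q.rev) ?_ hcA (mirror_mem_goodWords hy) ?_ hr
      (by simp [_root_.mirror, hyq, Dir.flip])
    · refine ⟨hy, fun j hj => ?_⟩
      have h1 := this.2 j.rev (Fin.rev_le_rev.2 hj)
      rwa [_root_.mirror, Dir.flip_eq_right, Fin.rev_rev] at h1
    · intro k
      have h1 := hA k.rev
      simp only [Fin.val_rev] at h1
      rwa [show m + 1 - ((k : ℕ) + 1) = m - (k + 1) + 1 by omega]
    · rw [hq]
      congr 1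
      simp only [Fin.val_rev]
      omega

end FollowsWord

end Path

/-! ### Transport along automorphisms, and counting by fibres -/

section Conjugation

variable {V : Type*} {G : SimpleGraph V} {A : Set V} {p : V → V}

theorem IsParentMap.conj (h : IsParentMap G A p) (e : G ≃g G) :
    IsParentMap G (e '' A) fun v => e (p (e.symm v)) := by
  have hr : ∀ v, Reaches p A v → Reaches (fun v => e (p (e.symm v))) (e '' A) (e v) := by
    intro v hv
    induction hv with
    | root hv => exact .root ⟨_, hv, rfl⟩
    | step _ ih =>
      refine .step ?_
      simpa using ih
  refine ⟨?_, fun v hv => ?_, fun v => ?_⟩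
  · rintro _ ⟨a, ha, rfl⟩
    simp [h.fixed a ha]
  · have hv' : e.symm v ∉ A := fun hA => hv ⟨_, hA, by simp⟩
    have := e.map_adj_iff.2 (h.adj _ hv')
    simpa using this
  · simpa using hr _ (h.reaches (e.symm v))

theorem ncard_parentMaps_image (e : G ≃g G) (A : Set V) :
    {p | IsParentMap G (e '' A) p}.ncard = {p | IsParentMap G A p}.ncard := by
  symm
  refine Set.ncard_congr (fun p _ v => e (p (e.symm v))) (fun p hp => hp.conj e) ?_ ?_
  · intro p q _ _ h
    funext v
    have := congrFun h (e v)
    simpa using this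
  · intro p hp
    refine ⟨fun v => e.symm (p (e v)), ?_, ?_⟩
    · have := IsParentMap.conj hp e.symm
      have himg : e.symm '' (e '' A) = A := by
        ext x
        simp
      rw [himg] at this
      exact this
    · funext v
      simp

end Conjugation

theorem Set.ncard_eq_sum_fiber {α β : Type*} [Finite α] [Fintype β] (S : Set α) (f : α → β) :
    S.ncard = ∑ b, {a ∈ S | f a = b}.ncard := by
  classical
  have := Fintype.ofFinite α
  simp only [Set.ncard_eq_toFinset_card']
  rw [Finset.card_eq_sum_card_fiberwise (f := f) (t := Finset.univ) (by simp)]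
  refine Finset.sum_congr rfl fun b _ => ?_
  congr 1
  ext a
  simp

/-! ### Parent maps of the wheel as direction words -/

section Wheel

variable {n : ℕ} [NeZero n]

theorem Fin.ofNat_add_one (k : ℕ) : Fin.ofNat n k + 1 = Fin.ofNat n (k + 1) := by
  ext
  simp [Fin.val_add]

theorem Fin.ofNat_succ_sub_one (k : ℕ) : Fin.ofNat n (k + 1) - 1 = Fin.ofNat n k := by
  rw [← Fin.ofNat_add_one, add_sub_cancel_right]

/-- The vertex of the wheel reached from the rim vertex `i` in direction `d`. -/
def wheelStep (d : Dir) (i : Fin n) : Option (Fin n) := d.dest (some (i - 1)) (some (i + 1)) none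

theorem wheelGraph_adj_some (hn : 3 ≤ n) {i : Fin n} {v : Option (Fin n)} :
    (wheelGraph n).Adj (some i) v ↔ ∃ d, v = wheelStep d i := by
  obtain ⟨k, rfl⟩ : ∃ k, n = k + 2 := ⟨n - 2, by omega⟩
  cases v with
  | none => exact ⟨fun _ => ⟨.spoke, rfl⟩, fun _ => trivial⟩
  | some j =>
    change (SimpleGraph.cycleGraph (k + 2)).Adj i j ↔ _
    rw [SimpleGraph.cycleGraph_adj]
    constructor
    · rintro (h | h)
      · refine ⟨.left, congrArg some ?_⟩
        rw [← h]
        abel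
      · refine ⟨.right, congrArg some ?_⟩
        rw [← h]
        abel
    · rintro ⟨d | d | d, h⟩
      · left
        rw [Option.some.inj h]
        abel
      · right
        rw [Option.some.inj h]
        abel
      · cases h

theorem wheelStep_injective (hn : 3 ≤ n) (i : Fin n) :
    Function.Injective fun d => wheelStep d i := by
  -- Here `3 ≤ n` is essential: on a shorter rim the left and right neighbours coincide.
  have hne : i - 1 ≠ i + 1 := by
    intro h
    rw [sub_eq_iff_eq_add, add_assoc, left_eq_add] at h
    have := congrArg Fin.val h
    simp only [Fin.val_add, Fin.val_one', Fin.val_zero] at this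
    rw [Nat.mod_eq_of_lt (show 1 < n by omega), Nat.mod_eq_of_lt (by omega)] at this
    omega
  rintro (_ | _ | _) (_ | _ | _) h <;> simp [wheelStep, Dir.dest, hne, hne.symm] at h ⊢

open Classical in
/-- The map fixing `A`, moving the other rim vertices as told by `D`, and sending the centre to the
rim vertex `q`. -/
noncomputable def wheelMap (A : Set (Option (Fin n))) (D : Fin n → Dir) (q : Fin n)
    (v : Option (Fin n)) : Option (Fin n) :=
  if v ∈ A then v else v.elim (some q) fun i => wheelStep (D i) i

variable {A : Set (Option (Fin n))} {D : Fin n → Dir} {q : Fin n}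

theorem wheelMap_of_mem {v : Option (Fin n)} (h : v ∈ A) : wheelMap A D q v = v := if_pos h

theorem wheelMap_some {i : Fin n} (h : some i ∉ A) :
    wheelMap A D q (some i) = wheelStep (D i) i := if_neg h

theorem wheelMap_none (h : none ∉ A) : wheelMap A D q none = some q := if_neg h

theorem isParentMap_wheelMap (hn : 3 ≤ n) (h : ∀ v, Reaches (wheelMap A D q) A v) :
    IsParentMap (wheelGraph n) A (wheelMap A D q) := by
  refine ⟨fun a ha => wheelMap_of_mem ha, fun v hv => ?_, h⟩
  cases v with
  | none => rw [wheelMap_none hv]; trivial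
  | some i => rw [wheelMap_some hv]; exact (wheelGraph_adj_some hn).2 ⟨_, rfl⟩

theorem IsParentMap.exists_eq_wheelMap (hn : 3 ≤ n) {p : Option (Fin n) → Option (Fin n)}
    (h : IsParentMap (wheelGraph n) A p) (hq : none ∈ A ∨ p none = some q) :
    ∃ D, p = wheelMap A D q := by
  have hd : ∀ i, ∃ d, some i ∉ A → p (some i) = wheelStep d i := by
    intro i
    by_cases hi : some i ∈ A
    · exact ⟨.spoke, fun h => absurd hi h⟩
    · obtain ⟨d, hd⟩ := (wheelGraph_adj_some hn).1 (h.adj _ hi)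
      exact ⟨d, fun _ => hd⟩
  choose D hD using hd
  refine ⟨D, funext fun v => ?_⟩
  by_cases hv : v ∈ A
  · rw [wheelMap_of_mem hv, h.fixed _ hv]
  · cases v with
    | none => rw [wheelMap_none hv, hq.resolve_left hv]
    | some i => rw [wheelMap_some hv, hD i hv]

theorem wheelMap_congr {D' : Fin n → Dir} (h : ∀ i, some i ∉ A → D i = D' i) :
    wheelMap A D q = wheelMap A D' q := by
  funext v
  by_cases hv : v ∈ A
  · rw [wheelMap_of_mem hv, wheelMap_of_mem hv]
  · cases v with
    | none => rw [wheelMap_none hv, wheelMap_none hv]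
    | some i => rw [wheelMap_some hv, wheelMap_some hv, h i hv]

/-- The positions `s + k` are reduced modulo `n`, so an arc ending where the rim closes up is still
an ordinary path. -/
theorem followsWord_wheelMap {m s : ℕ} {y : Fin m → Dir}
    (hA : ∀ k : Fin m, some (Fin.ofNat n (s + (k + 1))) ∉ A)
    (hD : ∀ k : Fin m, D (Fin.ofNat n (s + (k + 1))) = y k) :
    FollowsWord (wheelMap A D q) none (fun k => some (Fin.ofNat n (s + k))) y := by
  intro k
  change wheelMap A D q (some (Fin.ofNat n (s + (k + 1)))) = _
  rw [wheelMap_some (hA k), hD, wheelStep, ← add_assoc s, Fin.ofNat_succ_sub_one, Fin.ofNat_add_one]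
  rfl

/-- Rotation of the wheel. -/
def wheelRotation (t : Fin n) : wheelGraph n ≃g wheelGraph n where
  toEquiv := (Equiv.addRight t).optionCongr
  map_rel_iff' := by
    rintro (_ | i) (_ | j)
    · exact Iff.rfl
    · exact Iff.rfl
    · exact Iff.rfl
    · change (SimpleGraph.cycleGraph n).Adj (i + t) (j + t) ↔ (SimpleGraph.cycleGraph n).Adj i j
      rw [SimpleGraph.cycleGraph_adj', SimpleGraph.cycleGraph_adj', add_sub_add_right_eq_sub,
        add_sub_add_right_eq_sub]

theorem wheelRotation_some (t i : Fin n) : wheelRotation t (some i) = some (i + t) := rfl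

theorem wheelRotation_none (t : Fin n) : wheelRotation t none = none := rfl

end Wheel

/-! ### Two roots on the rim -/

section TwoRimRoots

variable {m₁ m₂ : ℕ}

/-- Two rim vertices separated by `m₁` vertices on one side and `m₂` on the other side. -/
def rimRoots (m₁ m₂ : ℕ) : Set (Option (Fin ((m₁ + 1) + (m₂ + 1)))) :=
  {some (Fin.castAdd (m₂ + 1) 0), some (Fin.natAdd (m₁ + 1) 0)}

/-- The rim word built from words on the two arcs between the roots. -/
def arcWord (y : (Fin m₁ → Dir) × (Fin m₂ → Dir)) : Fin ((m₁ + 1) + (m₂ + 1)) → Dir :=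
  -- The letter `spoke` at the two roots is a filler: `wheelMap` fixes the roots.
  Fin.append (Fin.cons .spoke y.1) (Fin.cons .spoke y.2)

theorem arcWord_left (y : (Fin m₁ → Dir) × (Fin m₂ → Dir)) (k : Fin m₁) :
    arcWord y (Fin.castAdd (m₂ + 1) k.succ) = y.1 k := by
  simp [arcWord]

theorem arcWord_right (y : (Fin m₁ → Dir) × (Fin m₂ → Dir)) (k : Fin m₂) :
    arcWord y (Fin.natAdd (m₁ + 1) k.succ) = y.2 k := by
  simp [arcWord]

theorem none_notMem_rimRoots : none ∉ rimRoots m₁ m₂ := by simp [rimRoots]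

theorem left_notMem_rimRoots (k : Fin m₁) :
    some (Fin.castAdd (m₂ + 1) k.succ) ∉ rimRoots m₁ m₂ := by
  simp only [rimRoots, Set.mem_insert_iff, Set.mem_singleton_iff, Option.some.injEq, Fin.ext_iff,
    Fin.val_castAdd, Fin.val_natAdd, Fin.val_succ, Fin.val_zero]
  omega

theorem right_notMem_rimRoots (k : Fin m₂) :
    some (Fin.natAdd (m₁ + 1) k.succ) ∉ rimRoots m₁ m₂ := by
  simp only [rimRoots, Set.mem_insert_iff, Set.mem_singleton_iff, Option.some.injEq, Fin.ext_iff,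
    Fin.val_castAdd, Fin.val_natAdd, Fin.val_succ, Fin.val_zero]
  omega

theorem ofNat_left (k : Fin m₁) :
    Fin.ofNat ((m₁ + 1) + (m₂ + 1)) (0 + (k + 1)) = Fin.castAdd (m₂ + 1) k.succ := by
  ext
  simp only [Fin.val_ofNat, Fin.val_castAdd, Fin.val_succ, zero_add]
  exact Nat.mod_eq_of_lt (by omega)

theorem ofNat_right (k : Fin m₂) :
    Fin.ofNat ((m₁ + 1) + (m₂ + 1)) (m₁ + 1 + (k + 1)) = Fin.natAdd (m₁ + 1) k.succ := by
  ext
  simp only [Fin.val_ofNat, Fin.val_natAdd, Fin.val_succ]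
  exact Nat.mod_eq_of_lt (by omega)

theorem ofNat_zero_mem_rimRoots :
    some (Fin.ofNat ((m₁ + 1) + (m₂ + 1)) 0) ∈ rimRoots m₁ m₂ := by
  left
  congr 1

theorem ofNat_succ_mem_rimRoots :
    some (Fin.ofNat ((m₁ + 1) + (m₂ + 1)) (m₁ + 1)) ∈ rimRoots m₁ m₂ := by
  right
  refine congrArg some (Fin.ext ?_)
  exact Nat.mod_eq_of_lt (by omega)

theorem ofNat_self_mem_rimRoots :
    some (Fin.ofNat ((m₁ + 1) + (m₂ + 1)) (m₁ + 1 + (m₂ + 1))) ∈ rimRoots m₁ m₂ := by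
  left
  refine congrArg some (Fin.ext ?_)
  exact Nat.mod_self _

theorem followsWord_left (y : (Fin m₁ → Dir) × (Fin m₂ → Dir)) (q : Fin ((m₁ + 1) + (m₂ + 1))) :
    FollowsWord (wheelMap (rimRoots m₁ m₂) (arcWord y) q) none
      (fun k => some (Fin.ofNat _ (0 + k))) y.1 := by
  refine followsWord_wheelMap (fun k => ?_) (fun k => ?_)
  · rw [ofNat_left]; exact left_notMem_rimRoots k
  · rw [ofNat_left]; exact arcWord_left y k

theorem followsWord_right (y : (Fin m₁ → Dir) × (Fin m₂ → Dir)) (q : Fin ((m₁ + 1) + (m₂ + 1))) :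
    FollowsWord (wheelMap (rimRoots m₁ m₂) (arcWord y) q) none
      (fun k => some (Fin.ofNat _ (m₁ + 1 + k))) y.2 := by
  refine followsWord_wheelMap (fun k => ?_) (fun k => ?_)
  · rw [ofNat_right]; exact right_notMem_rimRoots k
  · rw [ofNat_right]; exact arcWord_right y k

theorem wheelMap_arcWord_injective (hn : 3 ≤ (m₁ + 1) + (m₂ + 1))
    (q : Fin ((m₁ + 1) + (m₂ + 1))) :
    Function.Injective fun y : (Fin m₁ → Dir) × (Fin m₂ → Dir) =>
      wheelMap (rimRoots m₁ m₂) (arcWord y) q := by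
  intro y z h
  refine Prod.ext (funext fun k => ?_) (funext fun k => ?_)
  · have := congrFun h (some (Fin.castAdd (m₂ + 1) k.succ))
    simp only [wheelMap_some (left_notMem_rimRoots k), arcWord_left] at this
    exact wheelStep_injective hn _ this
  · have := congrFun h (some (Fin.natAdd (m₁ + 1) k.succ))
    simp only [wheelMap_some (right_notMem_rimRoots k), arcWord_right] at this
    exact wheelStep_injective hn _ this

/-- On good arcs every rim vertex flows to a root or to the centre, so only the orbit of the centre
remains to be controlled. -/
theorem reaches_wheelMap_arcWord (y : (Fin m₁ → Dir) × (Fin m₂ → Dir))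
    (q : Fin ((m₁ + 1) + (m₂ + 1))) :
    (∀ v, Reaches (wheelMap (rimRoots m₁ m₂) (arcWord y) q) (rimRoots m₁ m₂) v) ↔
      y.1 ∈ goodWords m₁ ∧ y.2 ∈ goodWords m₂ ∧
        Reaches (wheelMap (rimRoots m₁ m₂) (arcWord y) q) (rimRoots m₁ m₂) none := by
  constructor
  · intro h
    refine ⟨(followsWord_left y q).mem_goodWords (fun k => ?_) (fun k => h _),
      (followsWord_right y q).mem_goodWords (fun k => ?_) (fun k => h _), h none⟩
    · rw [ofNat_left]; exact left_notMem_rimRoots k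
    · rw [ofNat_right]; exact right_notMem_rimRoots k
  · rintro ⟨h1, h2, hc⟩ v
    cases v with
    | none => exact hc
    | some i =>
      induction i using Fin.addCases with
      | left i =>
        cases i using Fin.cases with
        | zero => exact .root (.inl rfl)
        | succ k =>
          have := (followsWord_left y q).of_good h1 (S := Reaches _ (rimRoots m₁ m₂))
            (fun _ => .step) hc (.root ofNat_zero_mem_rimRoots)
            (.root (by rw [zero_add]; exact ofNat_succ_mem_rimRoots)) k
          rwa [ofNat_left] at this
      | right i =>
        cases i using Fin.cases with
        | zero => exact .root (.inr rfl)
        | succ k =>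
          have := (followsWord_right y q).of_good h2 (S := Reaches _ (rimRoots m₁ m₂))
            (fun _ => .step) hc (.root ofNat_succ_mem_rimRoots)
            (.root ofNat_self_mem_rimRoots) k
          rwa [ofNat_right] at this

theorem ncard_parentMaps_rimRoots_fiber (hn : 3 ≤ (m₁ + 1) + (m₂ + 1))
    (q : Fin ((m₁ + 1) + (m₂ + 1))) (X : Set (Fin m₁ → Dir)) (Y : Set (Fin m₂ → Dir))
    (h : ∀ y, (∀ v, Reaches (wheelMap (rimRoots m₁ m₂) (arcWord y) q) (rimRoots m₁ m₂) v) ↔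
      y.1 ∈ X ∧ y.2 ∈ Y) :
    {p ∈ {p | IsParentMap (wheelGraph _) (rimRoots m₁ m₂) p} | p none = some q}.ncard =
      X.ncard * Y.ncard := by
  rw [← Set.ncard_prod, ← Set.ncard_image_of_injective _ (wheelMap_arcWord_injective hn q)]
  congr 1
  ext p
  constructor
  · rintro ⟨hp, hq⟩
    obtain ⟨D, rfl⟩ := IsParentMap.exists_eq_wheelMap hn hp (.inr hq)
    have hD : wheelMap (rimRoots m₁ m₂) (arcWord (fun k => D (Fin.castAdd (m₂ + 1) k.succ),
        fun k => D (Fin.natAdd (m₁ + 1) k.succ))) q = wheelMap (rimRoots m₁ m₂) D q := by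
      refine wheelMap_congr fun i hi => ?_
      induction i using Fin.addCases with
      | left i =>
        cases i using Fin.cases with
        | zero => exact absurd (.inl rfl) hi
        | succ k => exact arcWord_left _ k
      | right i =>
        cases i using Fin.cases with
        | zero => exact absurd (.inr rfl) hi
        | succ k => exact arcWord_right _ k
    refine ⟨_, (h _).1 ?_, hD⟩
    rw [hD]
    exact hp.reaches
  · rintro ⟨y, hy, rfl⟩
    exact ⟨isParentMap_wheelMap hn ((h y).2 hy), wheelMap_none none_notMem_rimRoots⟩

theorem ncard_fiber_root (hn : 3 ≤ (m₁ + 1) + (m₂ + 1)) {q : Fin ((m₁ + 1) + (m₂ + 1))}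
    (hq : some q ∈ rimRoots m₁ m₂) :
    {p ∈ {p | IsParentMap (wheelGraph _) (rimRoots m₁ m₂) p} | p none = some q}.ncard =
      (goodWords m₁).ncard * (goodWords m₂).ncard := by
  refine ncard_parentMaps_rimRoots_fiber hn q _ _ fun y => ?_
  rw [reaches_wheelMap_arcWord]
  have : Reaches (wheelMap (rimRoots m₁ m₂) (arcWord y) q) (rimRoots m₁ m₂) none := by
    refine .step ?_
    rw [wheelMap_none none_notMem_rimRoots]
    exact .root hq
  tauto

/-- The centre's orbit must leave along the arc containing its parent without returning, which
constrains that arc to `runs k`; the other arc stays an arbitrary good word. -/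
theorem ncard_fiber_left (hn : 3 ≤ (m₁ + 1) + (m₂ + 1)) (k : Fin m₁) :
    {p ∈ {p | IsParentMap (wheelGraph _) (rimRoots m₁ m₂) p} |
        p none = some (Fin.castAdd (m₂ + 1) k.succ)}.ncard =
      (runs k).ncard * (goodWords m₂).ncard := by
  refine ncard_parentMaps_rimRoots_fiber hn _ _ _ fun y => ?_
  rw [reaches_wheelMap_arcWord]
  have hF := followsWord_left y (Fin.castAdd (m₂ + 1) k.succ)
  have hstep : wheelMap (rimRoots m₁ m₂) (arcWord y) (Fin.castAdd (m₂ + 1) k.succ) none =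
      some (Fin.ofNat _ (0 + (k + 1))) := by
    rw [wheelMap_none none_notMem_rimRoots, ofNat_left]
  constructor
  · rintro ⟨h1, h2, hc⟩
    refine ⟨hF.mem_runs (fun j => ?_) none_notMem_rimRoots h1 hstep hc, h2⟩
    rw [ofNat_left]
    exact left_notMem_rimRoots j
  · rintro ⟨h1, h2⟩
    refine ⟨h1.elim And.left And.left, h2, .step ?_⟩
    rw [hstep]
    exact hF.of_run h1 (S := Reaches _ (rimRoots m₁ m₂)) (fun _ => .step)
      (.root ofNat_zero_mem_rimRoots) (.root (by rw [zero_add]; exact ofNat_succ_mem_rimRoots))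

theorem ncard_fiber_right (hn : 3 ≤ (m₁ + 1) + (m₂ + 1)) (k : Fin m₂) :
    {p ∈ {p | IsParentMap (wheelGraph _) (rimRoots m₁ m₂) p} |
        p none = some (Fin.natAdd (m₁ + 1) k.succ)}.ncard =
      (goodWords m₁).ncard * (runs k).ncard := by
  refine ncard_parentMaps_rimRoots_fiber hn _ _ _ fun y => ?_
  rw [reaches_wheelMap_arcWord]
  have hF := followsWord_right y (Fin.natAdd (m₁ + 1) k.succ)
  have hstep : wheelMap (rimRoots m₁ m₂) (arcWord y) (Fin.natAdd (m₁ + 1) k.succ) none =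
      some (Fin.ofNat _ (m₁ + 1 + (k + 1))) := by
    rw [wheelMap_none none_notMem_rimRoots, ofNat_right]
  constructor
  · rintro ⟨h1, h2, hc⟩
    refine ⟨h1, hF.mem_runs (fun j => ?_) none_notMem_rimRoots h2 hstep hc⟩
    rw [ofNat_right]
    exact right_notMem_rimRoots j
  · rintro ⟨h1, h2⟩
    refine ⟨h1, h2.elim And.left And.left, .step ?_⟩
    rw [hstep]
    exact hF.of_run h2 (S := Reaches _ (rimRoots m₁ m₂)) (fun _ => .step)
      (.root ofNat_succ_mem_rimRoots) (.root ofNat_self_mem_rimRoots)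

/-- Sum over the parent of the centre: each root contributes the product of the two good-word
counts, and each arc its total of runs times the count for the other arc. The `- 2` in each total of
runs becomes a term on the left. -/
theorem ncard_parentMaps_rimRoots (hn : 3 ≤ (m₁ + 1) + (m₂ + 1)) :
    {p | IsParentMap (wheelGraph _) (rimRoots m₁ m₂) p}.ncard +
        2 * Nat.fib (2 * m₁ + 2) + 2 * Nat.fib (2 * m₂ + 2) =
      2 * (Nat.fib (2 * m₁ + 2) * Nat.fib (2 * m₂ + 2) +
        Nat.fib (2 * m₁ + 1) * Nat.fib (2 * m₂ + 2) +
        Nat.fib (2 * m₁ + 2) * Nat.fib (2 * m₂ + 1)) := by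
  have hnone : {p ∈ {p | IsParentMap (wheelGraph _) (rimRoots m₁ m₂) p} |
      p none = none}.ncard = 0 := by
    rw [Set.ncard_eq_zero]
    refine Set.eq_empty_of_forall_notMem ?_
    rintro p ⟨hp, hq⟩
    exact (hp.adj none none_notMem_rimRoots).ne hq.symm
  rw [Set.ncard_eq_sum_fiber _ fun p => p none, Fintype.sum_option, hnone, Fin.sum_univ_add,
    Fin.sum_univ_succ, Fin.sum_univ_succ, ncard_fiber_root hn (.inl rfl),
    ncard_fiber_root hn (.inr rfl)]
  simp only [ncard_fiber_left hn, ncard_fiber_right hn, ← Finset.sum_mul, ← Finset.mul_sum,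
    ncard_goodWords]
  have h1 := sum_ncard_runs m₁
  have h2 := sum_ncard_runs m₂
  generalize ∑ q : Fin m₁, (runs q).ncard = s₁ at *
  generalize ∑ q : Fin m₂, (runs q).ncard = s₂ at *
  zify at *
  linear_combination (Nat.fib (2 * m₂ + 2) : ℤ) * h1 + (Nat.fib (2 * m₁ + 2) : ℤ) * h2

end TwoRimRoots

/-! ### The centre as a root -/

section CentralRoot

variable {m : ℕ}

/-- A single arc of `m` vertices with the root `some 0` at both ends. The parent `0` given to the
centre is a filler, since the centre is a root. -/
theorem ncard_parentMaps_some_none (hn : 3 ≤ m + 1) :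
    {p | IsParentMap (wheelGraph (m + 1)) {some 0, none} p}.ncard = Nat.fib (2 * m + 2) := by
  set A : Set (Option (Fin (m + 1))) := {some 0, none} with hA
  have hsucc : ∀ k : Fin m, some k.succ ∉ A := by
    intro k
    simp [hA]
  have hnone : none ∈ A := .inr rfl
  let f : (Fin m → Dir) → Fin (m + 1) → Dir := fun y => Fin.cons .spoke y
  have hf : ∀ y (k : Fin m), f y k.succ = y k := fun y k => rfl
  have hpos : ∀ k : Fin m, Fin.ofNat (m + 1) (0 + (k + 1)) = k.succ := by
    intro k
    ext
    simp only [Fin.val_ofNat, Fin.val_succ, zero_add]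
    exact Nat.mod_eq_of_lt (by omega)
  have hF : ∀ y, FollowsWord (wheelMap A (f y) 0) none (fun k => some (Fin.ofNat _ (0 + k))) y :=
    fun y => followsWord_wheelMap (fun k => by rw [hpos]; exact hsucc k)
      (fun k => by rw [hpos]; exact hf y k)
  have hr : ∀ y, (∀ v, Reaches (wheelMap A (f y) 0) A v) ↔ y ∈ goodWords m := by
    intro y
    constructor
    · intro h
      refine (hF y).mem_goodWords (fun k => ?_) fun k => h _
      rw [hpos]
      exact hsucc k
    · rintro h (_ | i)
      · exact .root hnone
      · cases i using Fin.cases with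
        | zero => exact .root (.inl rfl)
        | succ k =>
          have := (hF y).of_good h (S := Reaches _ A) (fun _ => .step) (.root hnone)
            (.root (.inl rfl))
            (.root (.inl (congrArg some (Fin.ext (by simp))))) k
          rwa [hpos] at this
  have hinj : Function.Injective fun y => wheelMap A (f y) 0 := by
    intro y z h
    funext k
    have := congrFun h (some k.succ)
    simp only [wheelMap_some (hsucc k)] at this
    exact wheelStep_injective hn _ this
  rw [← ncard_goodWords, ← Set.ncard_image_of_injective _ hinj]
  congr 1
  ext p
  constructor
  · intro hp
    obtain ⟨D, rfl⟩ := IsParentMap.exists_eq_wheelMap (q := 0) hn hp (.inl hnone)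
    have hD : wheelMap A (f fun k => D k.succ) 0 = wheelMap A D 0 := by
      refine wheelMap_congr fun i hi => ?_
      cases i using Fin.cases with
      | zero => exact absurd (.inl rfl) hi
      | succ k => rfl
    refine ⟨_, (hr _).1 ?_, hD⟩
    rw [hD]
    exact hp.reaches
  · rintro ⟨y, hy, rfl⟩
    exact isParentMap_wheelMap hn ((hr y).2 hy)

theorem goodWords_cyclic_adj {D : Fin (m + 2) → Dir} (hD : D ∈ goodWords (m + 2))
    (hends : ¬ (D 0 = .left ∧ D (Fin.last _) = .right)) (i : Fin (m + 2)) :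
    ¬ (D i = .right ∧ D (i + 1) = .left) := by
  induction i using Fin.lastCases with
  | last =>
    rw [Fin.last_add_one]
    exact fun h => hends h.symm
  | cast i =>
    have := hD i (by omega)
    rw [Fin.coeSucc_eq_succ]
    exact this

theorem Fin.eq_univ_of_add_one_mem {S : Set (Fin (m + 2))} {i : Fin (m + 2)} (hi : i ∈ S)
    (hS : ∀ j ∈ S, j + 1 ∈ S) (j : Fin (m + 2)) : j ∈ S := by
  have h : ∀ k : Fin (m + 2), i + k ∈ S := by
    intro k
    induction k using Fin.induction with
    | zero => simpa using hi
    | succ k ih =>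
      rw [← Fin.coeSucc_eq_succ, ← add_assoc]
      exact hS _ ih
  simpa using h (j - i)

theorem Fin.eq_univ_of_sub_one_mem {S : Set (Fin (m + 2))} {i : Fin (m + 2)} (hi : i ∈ S)
    (hS : ∀ j ∈ S, j - 1 ∈ S) (j : Fin (m + 2)) : j ∈ S := by
  have := Fin.eq_univ_of_add_one_mem (S := {j | -j ∈ S}) (i := -i) (by simpa using hi)
    (fun j hj => by
      have := hS _ hj
      rwa [sub_eq_add_neg, ← neg_add] at this) (-j)
  simpa using this

/-- Besides opposed neighbours, now also across the seam, the only possible cycles are the two tours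
of the whole rim, that is, the constant words `left` and `right`. -/
theorem reaches_wheelMap_none {D : Fin (m + 2) → Dir} :
    (∀ v, Reaches (wheelMap {none} D 0) {none} v) ↔ D ∈ cyclicWords m := by
  have hsome : ∀ i : Fin (m + 2), some i ∉ ({none} : Set (Option (Fin (m + 2)))) := by simp
  have hstep : ∀ i, wheelMap {none} D 0 (some i) = wheelStep (D i) i :=
    fun i => wheelMap_some (hsome i)
  constructor
  · intro h
    -- The path starts at the last rim vertex, so that its inner position `k + 1` is rim vertex `k`.
    have hpos : ∀ k : Fin (m + 2), Fin.ofNat (m + 2) (m + 1 + (k + 1)) = k := by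
      intro k
      ext
      simp only [Fin.val_ofNat]
      rw [show m + 1 + ((k : ℕ) + 1) = k + (m + 2) by omega, Nat.add_mod_right,
        Nat.mod_eq_of_lt k.isLt]
    have hF : FollowsWord (wheelMap {none} D 0) none
        (fun k => some (Fin.ofNat (m + 2) (m + 1 + k))) D :=
      followsWord_wheelMap (fun k => hsome _) (fun k => by rw [hpos])
    refine ⟨hF.mem_goodWords (fun k => hsome _) (fun k => h _), ?_, ?_, ?_⟩
    · rintro ⟨h0, hl⟩
      refine Reaches.not_of_invariant (S := {some 0, some (Fin.last _)}) ?_ (.inl rfl) (h (some 0))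
      rintro x (rfl | rfl)
      · refine ⟨hsome _, .inr ?_⟩
        rw [hstep, h0]
        refine congrArg some ?_
        rw [sub_eq_iff_eq_add, Fin.last_add_one]
      · refine ⟨hsome _, .inl ?_⟩
        rw [hstep, hl]
        exact congrArg some (Fin.last_add_one _)
    · rintro rfl
      refine Reaches.not_of_invariant (S := Set.range some) ?_ ⟨0, rfl⟩ (h (some 0))
      rintro _ ⟨i, rfl⟩
      exact ⟨hsome i, by rw [hstep]; exact ⟨_, rfl⟩⟩
    · rintro rfl
      refine Reaches.not_of_invariant (S := Set.range some) ?_ ⟨0, rfl⟩ (h (some 0))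
      rintro _ ⟨i, rfl⟩
      exact ⟨hsome i, by rw [hstep]; exact ⟨_, rfl⟩⟩
  · rintro ⟨hD, hends, hl, hr⟩
    have hadj := goodWords_cyclic_adj hD hends
    have hspoke : ∀ i, D i = .spoke → Reaches (wheelMap {none} D 0) {none} (some i) := by
      intro i hi
      refine .step ?_
      rw [hstep, hi]
      exact .root rfl
    have hright : ∀ i, D i = .right → Reaches (wheelMap {none} D 0) {none} (some i) := by
      intro i hi
      by_contra hn
      refine hr (funext fun j => ?_)
      -- A `right` that never reaches the centre is followed by another such `right`; going round
      -- the rim makes the word constant.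
      refine (Fin.eq_univ_of_add_one_mem
        (S := {i | D i = .right ∧ ¬ Reaches (wheelMap {none} D 0) {none} (some i)})
        ⟨hi, hn⟩ ?_ j).1
      rintro i ⟨hi, hn⟩
      have hn' : ¬ Reaches (wheelMap {none} D 0) {none} (some (i + 1)) := fun h =>
        hn (.step (by rw [hstep, hi]; exact h))
      refine ⟨?_, hn'⟩
      cases hd : D (i + 1) with
      | left => exact absurd ⟨hi, hd⟩ (hadj i)
      | right => rfl
      | spoke => exact absurd (hspoke _ hd) hn'
    have hleft : ∀ i, D i = .left → Reaches (wheelMap {none} D 0) {none} (some i) := by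
      intro i hi
      by_contra hn
      refine hl (funext fun j => ?_)
      refine (Fin.eq_univ_of_sub_one_mem
        (S := {i | D i = .left ∧ ¬ Reaches (wheelMap {none} D 0) {none} (some i)})
        ⟨hi, hn⟩ ?_ j).1
      rintro i ⟨hi, hn⟩
      have hn' : ¬ Reaches (wheelMap {none} D 0) {none} (some (i - 1)) := fun h =>
        hn (.step (by rw [hstep, hi]; exact h))
      refine ⟨?_, hn'⟩
      cases hd : D (i - 1) with
      | left => rfl
      | right => exact absurd ⟨hd, by rwa [sub_add_cancel]⟩ (hadj (i - 1))
      | spoke => exact absurd (hspoke _ hd) hn'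
    rintro (_ | i)
    · exact .root rfl
    · cases hd : D i with
      | left => exact hleft i hd
      | right => exact hright i hd
      | spoke => exact hspoke i hd

theorem ncard_parentMaps_none (hn : 3 ≤ m + 2) :
    {p | IsParentMap (wheelGraph (m + 2)) {none} p}.ncard = (cyclicWords m).ncard := by
  have hinj : Function.Injective fun D : Fin (m + 2) → Dir => wheelMap {none} D 0 := by
    intro D D' h
    funext i
    have := congrFun h (some i)
    simp only [wheelMap_some (show some i ∉ ({none} : Set (Option (Fin (m + 2)))) by simp)] at this
    exact wheelStep_injective hn _ this
  rw [← Set.ncard_image_of_injective _ hinj]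
  congr 1
  ext p
  constructor
  · intro hp
    obtain ⟨D, rfl⟩ := IsParentMap.exists_eq_wheelMap (q := 0) hn hp (.inl rfl)
    exact ⟨D, reaches_wheelMap_none.1 hp.reaches, rfl⟩
  · rintro ⟨D, hD, rfl⟩
    exact isParentMap_wheelMap hn (reaches_wheelMap_none.2 hD)

theorem numSpanningTrees_wheelGraph (m : ℕ) (hm : 1 ≤ m) :
    numSpanningTrees (wheelGraph (m + 2)) + Nat.fib (2 * m + 2) + 2 = Nat.fib (2 * m + 6) := by
  rw [numSpanningTrees_eq_ncard_parentMaps _ none, ncard_parentMaps_none (by omega),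
    ncard_cyclicWords]

end CentralRoot

/-! ### Rotation to standard position and evaluation -/

theorem lucasNumber_succ (k : ℕ) : lucasNumber (k + 1) = Nat.fib k + Nat.fib (k + 2) := by
  induction k using Nat.twoStepInduction with
  | zero => rfl
  | one => rfl
  | more k h0 h1 =>
    rw [lucasNumber, h0, h1, Nat.fib_add_two (n := k), Nat.fib_add_two (n := k + 2)]
    rw [Nat.fib_add_two (n := k)]
    ring

/-- The number of two-component spanning forests of the wheel separating two rim vertices, the second of
which is `m₁ + 1` steps ahead of the first. -/
theorem numTwoForests_rim {n : ℕ} (hn : 3 ≤ n) {i j : Fin n} {m₁ m₂ : ℕ}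
    (hd : (j - i).val = m₁ + 1) (hm : n = (m₁ + 1) + (m₂ + 1)) :
    numTwoForests (wheelGraph n) (some i) (some j) +
        2 * Nat.fib (2 * m₁ + 2) + 2 * Nat.fib (2 * m₂ + 2) =
      2 * (Nat.fib (2 * m₁ + 2) * Nat.fib (2 * m₂ + 2) +
        Nat.fib (2 * m₁ + 1) * Nat.fib (2 * m₂ + 2) +
        Nat.fib (2 * m₁ + 2) * Nat.fib (2 * m₂ + 1)) := by
  subst hm
  have hne : some i ≠ some j := by
    intro h
    rw [Option.some.inj h, sub_self] at hd
    simp at hd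
  -- Rotation by `i` carries `0` to `i` and `j - i`, which is position `m₁ + 1`, to `j`.
  have himg : ({some i, some j} : Set (Option (Fin ((m₁ + 1) + (m₂ + 1))))) =
      wheelRotation i '' rimRoots m₁ m₂ := by
    have h0 : Fin.castAdd (m₂ + 1) (0 : Fin (m₁ + 1)) = 0 := rfl
    have h1 : Fin.natAdd (m₁ + 1) (0 : Fin (m₂ + 1)) = j - i := Fin.ext hd.symm
    rw [rimRoots, Set.image_pair, wheelRotation_some, wheelRotation_some, h0, h1, zero_add,
      sub_add_cancel]
  rw [numTwoForests_eq_ncard_parentMaps _ _ _ hne, himg, ncard_parentMaps_image,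
    ncard_parentMaps_rimRoots hn]

theorem numTwoForests_center {m : ℕ} (hn : 3 ≤ m + 1) (i : Fin (m + 1)) :
    numTwoForests (wheelGraph (m + 1)) (some i) none = Nat.fib (2 * m + 2) := by
  have himg : ({some i, none} : Set (Option (Fin (m + 1)))) =
      wheelRotation i '' {some 0, none} := by
    rw [Set.image_pair, wheelRotation_some, wheelRotation_none, zero_add]
  rw [numTwoForests_eq_ncard_parentMaps _ _ _ (by simp), himg, ncard_parentMaps_image,
    ncard_parentMaps_some_none hn]

theorem Fin.val_sub_add_val_sub {n : ℕ} {i j : Fin n} (h : i ≠ j) :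
    (i - j).val + (j - i).val = n := by
  rcases lt_or_gt_of_ne h with h | h
  · rw [Fin.coe_sub_iff_lt.2 h, Fin.coe_sub_iff_le.2 h.le]
    have : i.val < j.val := h
    omega
  · rw [Fin.coe_sub_iff_le.2 h.le, Fin.coe_sub_iff_lt.2 h]
    have : j.val < i.val := h
    omega

theorem val_sub_of_rimDist {n d : ℕ} (hd : 0 < d) {i j : Fin n} (h : rimDist i j = d) :
    i ≠ j ∧ ((i - j).val = d ∨ (j - i).val = d) := by
  have hne : i ≠ j := by
    rintro rfl
    simp [rimDist] at h
    omega
  refine ⟨hne, ?_⟩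
  rw [rimDist] at h
  rcases lt_or_gt_of_ne hne with hlt | hlt
  · have hlt' : i.val < j.val := hlt
    rw [Fin.coe_sub_iff_lt.2 hlt, Fin.coe_sub_iff_le.2 hlt.le]
    omega
  · have hlt' : j.val < i.val := hlt
    rw [Fin.coe_sub_iff_le.2 hlt.le, Fin.coe_sub_iff_lt.2 hlt]
    omega

theorem numTwoForests_adjacent {k : ℕ} {i j : Fin (k + 3)}
    (h : (wheelGraph (k + 3)).Adj (some i) (some j)) :
    numTwoForests (wheelGraph (k + 3)) (some i) (some j) + 2 = 2 * Nat.fib (2 * k + 5) := by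
  have hne : i ≠ j := fun he => h.ne (congrArg some he)
  have hsum := Fin.val_sub_add_val_sub hne
  have e : Nat.fib (2 * k + 5) = Nat.fib (2 * k + 3) + Nat.fib (2 * k + 4) := Nat.fib_add_two
  have hadj : (SimpleGraph.cycleGraph (k + 3)).Adj i j := h
  rcases SimpleGraph.cycleGraph_adj'.1 hadj with h1 | h1
  · have := numTwoForests_rim (by omega) (i := i) (j := j) (m₁ := k + 1) (m₂ := 0) (by omega)
      (by omega)
    simp only [Nat.mul_zero, Nat.zero_add, Nat.fib_two, Nat.fib_one] at this
    rw [show 2 * (k + 1) + 2 = 2 * k + 4 by ring, show 2 * (k + 1) + 1 = 2 * k + 3 by ring] at this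
    omega
  · have := numTwoForests_rim (by omega) (i := i) (j := j) (m₁ := 0) (m₂ := k + 1) (by omega)
      (by omega)
    simp only [Nat.mul_zero, Nat.zero_add, Nat.fib_two, Nat.fib_one] at this
    rw [show 2 * (k + 1) + 2 = 2 * k + 4 by ring, show 2 * (k + 1) + 1 = 2 * k + 3 by ring] at this
    omega

theorem numTwoForests_distance_two {k : ℕ} {i j : Fin (k + 4)} (h : rimDist i j = 2) :
    numTwoForests (wheelGraph (k + 4)) (some i) (some j) + 6 = 2 * lucasNumber (2 * k + 6) := by
  obtain ⟨hne, h1⟩ := val_sub_of_rimDist (by omega) h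
  have hsum := Fin.val_sub_add_val_sub hne
  have e1 : Nat.fib (2 * k + 7) = Nat.fib (2 * k + 5) + Nat.fib (2 * k + 6) := Nat.fib_add_two
  have e2 : Nat.fib (2 * k + 6) = Nat.fib (2 * k + 4) + Nat.fib (2 * k + 5) := Nat.fib_add_two
  have e3 : Nat.fib (2 * k + 5) = Nat.fib (2 * k + 3) + Nat.fib (2 * k + 4) := Nat.fib_add_two
  have f3 : Nat.fib 3 = 2 := rfl
  have f4 : Nat.fib 4 = 3 := rfl
  have hl : lucasNumber (2 * k + 6) = Nat.fib (2 * k + 5) + Nat.fib (2 * k + 7) :=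
    lucasNumber_succ (2 * k + 5)
  rcases h1 with h1 | h1
  · have := numTwoForests_rim (by omega) (i := i) (j := j) (m₁ := k + 1) (m₂ := 1) (by omega)
      (by omega)
    rw [show 2 * (k + 1) + 2 = 2 * k + 4 by ring, show 2 * (k + 1) + 1 = 2 * k + 3 by ring] at this
    norm_num only [f3, f4] at this
    omega
  · have := numTwoForests_rim (by omega) (i := i) (j := j) (m₁ := 1) (m₂ := k + 1) (by omega)
      (by omega)
    rw [show 2 * (k + 1) + 2 = 2 * k + 4 by ring, show 2 * (k + 1) + 1 = 2 * k + 3 by ring] at this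
    norm_num only [f3, f4] at this
    omega

theorem mainTheorem2 (n : ℕ) (hn : 3 ≤ n) :
    (∀ i j : Fin n, (wheelGraph n).Adj (some i) (some j) →
      (numTwoForests (wheelGraph n) (some i) (some j) : ℤ)
        = 2 * ((Nat.fib (2 * n - 1) : ℤ) - 1)) ∧
    (∀ i j : Fin n, rimDist i j = 2 →
      (numTwoForests (wheelGraph n) (some i) (some j) : ℤ)
          = 2 * ((lucasNumber (2 * n - 2) : ℤ) - 3) ∧
      2 * ((lucasNumber (2 * n - 2) : ℤ) - 3)
          = 2 * ((numSpanningTrees (wheelGraph (n - 1)) : ℤ) - 1)) ∧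
    (∀ i : Fin n,
      numTwoForests (wheelGraph n) (some i) none = Nat.fib (2 * n)) := by
  refine ⟨fun i j h => ?_, fun i j h => ?_, fun i => ?_⟩
  · obtain ⟨k, rfl⟩ : ∃ k, n = k + 3 := ⟨n - 3, by omega⟩
    have := numTwoForests_adjacent h
    rw [show 2 * (k + 3) - 1 = 2 * k + 5 by omega]
    omega
  · have h4 : 4 ≤ n := by
      rw [rimDist] at h
      omega
    obtain ⟨k, rfl⟩ : ∃ k, n = k + 4 := ⟨n - 4, by omega⟩
    have h1 := numTwoForests_distance_two h
    -- The smaller wheel has `n - 1 = (k + 1) + 2` rim vertices.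
    have h2 := numSpanningTrees_wheelGraph (k + 1) (by omega)
    have h3 := lucasNumber_succ (2 * k + 5)
    have e1 : Nat.fib (2 * (k + 1) + 6) = Nat.fib (2 * k + 6) + Nat.fib (2 * k + 7) :=
      Nat.fib_add_two
    have e2 : Nat.fib (2 * k + 6) = Nat.fib (2 * k + 4) + Nat.fib (2 * k + 5) := Nat.fib_add_two
    rw [show 2 * (k + 1) + 2 = 2 * k + 4 by ring] at h2
    rw [show 2 * (k + 4) - 2 = 2 * k + 6 by omega, show k + 4 - 1 = k + 1 + 2 by omega]
    change lucasNumber (2 * k + 6) = Nat.fib (2 * k + 5) + Nat.fib (2 * k + 7) at h3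
    omega
  · obtain ⟨m, rfl⟩ : ∃ m, n = m + 1 := ⟨n - 1, by omega⟩
    exact numTwoForests_center hn i
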